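/- Let $a,b\in\mathbb R$ with $b\neq 0$, and let $g\in L^2(\mathbb R)$ (complex-valued). For $c\in\mathbb R$ put $T_cf(x)=f(x-c)$ and $E_cf(x)=e^{2\pi i c x}f(x)$, and let $\langle\cdot,\cdot\rangle$ be the inner product of $L^2(\mathbb R)$, linear in the first variable. Assume $g\in\mathbf{PF}$, i.e. there is a constant $B$ with $$\sum_{m,n\in\mathbb Z}|\langle f,E_{mb}T_{na}g\rangle|^2\le B\|f\|^2\qquad\text{for all } f\in L^2(\mathbb R),$$ and let $Sf=\sum_{m,n\in\mathbb Z}\langle f,E_{mb}T_{na}g\rangle E_{mb}T_{na}g$ be the frame operator. For $k\in\mathbb Z$ let $$G_k(t)=\sum_{n\in\mathbb Z}g(t-na)\,\overline{g(t-na-k/b)} .$$ Then for every $k\in\mathbb Z$ the map $f\mapsto (T_{k/b}f)\,G_k$ is a bounded linear operator on $L^2(\mathbb R)$. For finite $M\subset\mathbb Z$ let $S_Mf=\sum_{k\in M}(T_{k/b}f)\,G_k$; the series $\sum_{k\in\mathbb Z}(T_{k/b}f)\,G_k$ is called the Walnut series of $f$. The following are equivalent: (1) The Walnut series of $f$ converges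 weakly unconditionally in $L^2(\mathbb R)$ for every $f\in L^2(\mathbb R)$. (2) The Walnut series of $f$ converges unconditionally in norm in $L^2(\mathbb R)$ for every $f\in L^2(\mathbb R)$. (3) $\sup\{\|S_M\| : M\subset\mathbb Z,\ |M|<\infty\}<\infty$. (4) For every $f\in L^2(\mathbb R)$ the series $\frac1{|b|}\sum_{k\in\mathbb Z}\langle (T_{k/b}f)\,G_k,f\rangle$ converges unconditionally to $\langle Sf,f\rangle$. (5) For every $f\in L^2(\mathbb R)$ the WH-frame identity $$\sum_{m,n\in\mathbb Z}|\langle f,E_{mb}T_{na}g\rangle|^2=\frac1{|b|}\sum_{k\in\mathbb Z}\int_{\mathbb R}\overline{f(t)}\,f(t-k/b)\,G_k(t)\,dt$$ holds: the left side is finite, the integrals on the right exist, the series on the right converges unconditionally, and the two sides are equal. -/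

import Mathlib

open MeasureTheory ComplexConjugate

noncomputable section

namespace WH

/-- The complex Hilbert space `L²(ℝ)`. -/
abbrev L2 : Type := Lp ℂ 2 (volume : Measure ℝ)

/-- Translation `T_c f (x) = f (x - c)` on `L²(ℝ)`. -/
def translate (c : ℝ) (f : L2) : L2 :=
  Lp.compMeasurePreserving (fun x : ℝ => x - c) (measurePreserving_sub_right volume c) f

theorem memLp_modulate (c : ℝ) (f : L2) :
    MemLp (fun x : ℝ => Complex.exp (2 * Real.pi * Complex.I * c * x) * f x) 2 volume := by
  refine (Lp.memLp f).of_le ?_ (Filter.Eventually.of_forall fun x => ?_)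
  · refine AEStronglyMeasurable.mul ?_ (Lp.aestronglyMeasurable f)
    exact (by fun_prop : Continuous fun x : ℝ =>
      Complex.exp (2 * Real.pi * Complex.I * c * x)).aestronglyMeasurable
  · have h : (2 * Real.pi * Complex.I * c * x : ℂ)
        = ((2 * Real.pi * c * x : ℝ) : ℂ) * Complex.I := by
      push_cast; ring
    rw [norm_mul, h, Complex.norm_exp_ofReal_mul_I, one_mul]

/-- Modulation `E_c f (x) = exp (2 π i c x) f (x)` on `L²(ℝ)`. -/
def modulate (c : ℝ) (f : L2) : L2 := (memLp_modulate c f).toLp _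

/-- The Weyl-Heisenberg system `(E_{mb} T_{na} g)`, indexed by `p = (m, n) ∈ ℤ × ℤ`. -/
def system (a b : ℝ) (g : L2) (p : ℤ × ℤ) : L2 :=
  modulate (p.1 * b) (translate (p.2 * a) g)

/-- The elements of the system are, almost everywhere, the expected functions. -/
theorem coeFn_system (a b : ℝ) (g : L2) (p : ℤ × ℤ) :
    (system a b g p : ℝ → ℂ) =ᵐ[volume] fun x =>
      Complex.exp (2 * Real.pi * Complex.I * ((p.1 * b : ℝ) : ℂ) * x) * g (x - p.2 * a) := by
  have h1 := MemLp.coeFn_toLp (memLp_modulate (p.1 * b) (translate (p.2 * a) g))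
  have h2 := Lp.coeFn_compMeasurePreserving g
    (measurePreserving_sub_right (volume : Measure ℝ) (p.2 * a))
  filter_upwards [h1, h2] with x hx1 hx2
  refine hx1.trans ?_
  exact congrArg _ hx2

/-- The class PF of preframe functions: `g ∈ L²(ℝ)` such that the Weyl-Heisenberg system
`(g, a, b)` has a finite upper frame bound.  With Mathlib's convention,
`inner ℂ x f` is the inner product `⟨f, x⟩` that is linear in `f`. -/
def IsPreframe (a b : ℝ) (g : L2) : Prop :=
  ∃ B : ℝ, ∀ f : L2, Summable (fun p : ℤ × ℤ => ‖inner ℂ (system a b g p) f‖ ^ 2) ∧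
    ∑' p : ℤ × ℤ, ‖inner ℂ (system a b g p) f‖ ^ 2 ≤ B * ‖f‖ ^ 2

/-- The frame operator `S f = ∑_{m,n} ⟨f, E_{mb} T_{na} g⟩ E_{mb} T_{na} g`. -/
def frameOperator (a b : ℝ) (g f : L2) : L2 :=
  ∑' p : ℤ × ℤ, inner ℂ (system a b g p) f • system a b g p

/-- For `g ∈ PF` the series that defines `S f` converges unconditionally in `L²(ℝ)`. -/
theorem summable_frameOperator (a b : ℝ) (g : L2) (hg : IsPreframe a b g) (f : L2) :
    Summable fun p : ℤ × ℤ => inner ℂ (system a b g p) f • system a b g p := by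
  obtain ⟨B, hB⟩ := hg
  set e := system a b g
  set c : ℤ × ℤ → ℂ := fun p => inner ℂ (e p) f
  have key : ∀ F : Finset (ℤ × ℤ), ‖∑ p ∈ F, c p • e p‖ ^ 2 ≤ |B| * ∑ p ∈ F, ‖c p‖ ^ 2 := by
    intro F
    set v := ∑ p ∈ F, c p • e p
    have hA : 0 ≤ ∑ p ∈ F, ‖c p‖ ^ 2 := Finset.sum_nonneg fun _ _ => by positivity
    have h1 : ‖v‖ ^ 2 ≤ ∑ p ∈ F, ‖c p‖ * ‖inner ℂ (e p) v‖ := by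
      have h : (inner ℂ v v : ℂ) = ∑ p ∈ F, c p * inner ℂ v (e p) := by
        conv_lhs => rw [show inner ℂ v v = inner ℂ v (∑ p ∈ F, c p • e p) from rfl]
        rw [inner_sum]
        simp only [inner_smul_right]
      have h' : ‖v‖ ^ 2 = ‖(inner ℂ v v : ℂ)‖ := by
        rw [inner_self_eq_norm_sq_to_K]; simp
      rw [h', h]
      refine (norm_sum_le _ _).trans (Finset.sum_le_sum fun p _ => ?_)
      rw [norm_mul, norm_inner_symm v (e p)]
    have h2 : (∑ p ∈ F, ‖c p‖ * ‖inner ℂ (e p) v‖) ^ 2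
        ≤ (∑ p ∈ F, ‖c p‖ ^ 2) * ∑ p ∈ F, ‖inner ℂ (e p) v‖ ^ 2 :=
      Finset.sum_mul_sq_le_sq_mul_sq _ _ _
    have h3 : ∑ p ∈ F, ‖inner ℂ (e p) v‖ ^ 2 ≤ |B| * ‖v‖ ^ 2 :=
      (((hB v).1.sum_le_tsum F fun _ _ => by positivity).trans (hB v).2).trans
        (mul_le_mul_of_nonneg_right (le_abs_self B) (by positivity))
    have h4 : (‖v‖ ^ 2) ^ 2 ≤ (∑ p ∈ F, ‖c p‖ ^ 2) * (|B| * ‖v‖ ^ 2) :=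
      ((pow_le_pow_left₀ (by positivity) h1 2).trans h2).trans
        (mul_le_mul_of_nonneg_left h3 hA)
    rcases (sq_nonneg ‖v‖).eq_or_lt with h0 | h0
    · rw [← h0]; positivity
    · nlinarith
  rw [summable_iff_vanishing_norm]
  intro ε hε
  obtain ⟨s, hs⟩ := (summable_iff_vanishing_norm.1 (hB f).1) (ε ^ 2 / (|B| + 1)) (by positivity)
  refine ⟨s, fun t ht => ?_⟩
  have h5 := hs t ht
  have h6 : 0 ≤ ∑ p ∈ t, ‖c p‖ ^ 2 := Finset.sum_nonneg fun _ _ => by positivity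
  rw [Real.norm_of_nonneg h6, lt_div_iff₀ (by positivity)] at h5
  have h7 := key t
  exact lt_of_pow_lt_pow_left₀ 2 hε.le (by nlinarith)

/-- The function `G_k (t) = ∑_n g (t - n a) * conj (g (t - n a - k / b))`. -/
def corr (a b : ℝ) (g : L2) (k : ℤ) (t : ℝ) : ℂ :=
  ∑' n : ℤ, g (t - n * a) * conj (g (t - n * a - k / b))

/-- Weak unconditional convergence of a series in `L²(ℝ)`: the finite partial sums converge
weakly to some `h`, along the directed set of finite sets of indices. -/
def WeaklySummable (x : ℤ → L2) : Prop :=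
  ∃ h : L2, ∀ φ : L2, HasSum (fun k => inner ℂ φ (x k)) (inner ℂ φ h)

/-- The WH-frame identity holds for `f`:
`∑_{m,n} |⟨f, E_{mb} T_{na} g⟩|² = |b|⁻¹ ∑_k ∫ conj (f t) f (t - k / b) G_k (t) dt`,
where the left side is finite, the integrals exist, and the series on the right side
converges unconditionally. -/
def FrameIdentityHolds (a b : ℝ) (g f : L2) : Prop :=
  Summable (fun p : ℤ × ℤ => ‖inner ℂ (system a b g p) f‖ ^ 2) ∧
  (∀ k : ℤ, Integrable fun t : ℝ => conj (f t) * f (t - k / b) * corr a b g k t) ∧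
  HasSum
    (fun k : ℤ => ((|b|⁻¹ : ℝ) : ℂ) *
      ∫ t : ℝ, conj (f t) * f (t - k / b) * corr a b g k t)
    ((∑' p : ℤ × ℤ, ‖inner ℂ (system a b g p) f‖ ^ 2 : ℝ) : ℂ)

end WH

end

open MeasureTheory ComplexConjugate

noncomputable section

namespace WH

/-! Cut the line into cells of length `|b|⁻¹`. Translation by `k / b` permutes the cells, so for `f`
supported in one cell the Walnut terms live in distinct cells and are mutually orthogonal. All
convergence questions become easy there, and a uniform bound on the partial sums carries the answer
to all of `L²`.

The preframe bound, tested on indicators of subsets of a cell, bounds `∑ |g (t - n a)|²` almost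
everywhere. This bounds `g` and every `G_k`, so the Walnut operators exist.

Weak convergence gives (3) by applying uniform boundedness twice. Given (3), the partial sums for a
function on a cell are bounded and orthogonal, hence converge; the vectors of convergence form a
closed subspace, so (2) follows. To identify the sum with `|b| S`, pair functions from two cells: a
single `k` survives, and Parseval over modulations followed by dominated convergence over
translations gives the identity (`inner_frameOperator_of_cells`). Finally, (4) is a statement about
quadratic forms, which polarization turns into weak convergence, and (5) is (4) written with
integrals. -/

/-! ### Fourier series on the cells -/

/-- The character `t ↦ exp (2 π i m b t)`. -/
def char (b : ℝ) (m : ℤ) (t : ℝ) : ℂ :=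
  Complex.exp (2 * Real.pi * Complex.I * ((m * b : ℝ) : ℂ) * t)

/-- Parseval's identity for the Fourier coefficients of two functions on an interval. -/
theorem hasSum_conj_fourierCoeffOn_mul {s T : ℝ} (hT : s < s + T) {F H : ℝ → ℂ}
    (hF : MemLp F 2 (volume.restrict (Set.Ioc s (s + T))))
    (hH : MemLp H 2 (volume.restrict (Set.Ioc s (s + T)))) :
    HasSum (fun i => conj (fourierCoeffOn hT H i) * fourierCoeffOn hT F i)
      ((T⁻¹ : ℝ) * ∫ x in Set.Ioc s (s + T), conj (H x) * F x) := by
  have hT' : Fact (0 < T) := ⟨by linarith⟩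
  have hF' := hF.memLp_liftIoc.haarAddCircle
  have hH' := hH.memLp_liftIoc.haarAddCircle
  have h := (fourierBasis (T := T)).hasSum_inner_mul_inner hH'.toLp hF'.toLp
  convert! h using 1
  · funext i
    rw [← inner_conj_symm, ← HilbertBasis.repr_apply_apply, ← HilbertBasis.repr_apply_apply,
      fourierBasis_repr, fourierBasis_repr, fourierCoeff_congr_ae hF'.coeFn_toLp,
      fourierCoeff_congr_ae hH'.coeFn_toLp, fourierCoeff_liftIoc_eq, fourierCoeff_liftIoc_eq]
  · rw [L2.inner_def, ← intervalIntegral.integral_of_le hT.le,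
      ← AddCircle.integral_liftIoc_eq_intervalIntegral, ← Complex.real_smul,
      ← AddCircle.integral_haarAddCircle]
    apply integral_congr_ae
    filter_upwards [hF'.coeFn_toLp, hH'.coeFn_toLp] with x hx hy
    rw [hx, hy, RCLike.inner_apply']
    rfl

theorem fourierCoeffOn_eq_setIntegral {s T : ℝ} (hT : s < s + T) (F : ℝ → ℂ) (i : ℤ) :
    fourierCoeffOn hT F i = (T⁻¹ : ℝ) *
      ∫ x in Set.Ioc s (s + T), conj (char T⁻¹ i x) * F x := by
  rw [fourierCoeffOn_eq_integral, intervalIntegral.integral_of_le hT.le]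
  simp only [add_sub_cancel_left, one_div, Complex.real_smul, smul_eq_mul]
  congr! 3
  rw [fourier_neg, fourier_coe_apply, char]
  congr! 3
  push_cast
  ring

/-- The set of the points `t` with `⌊t b⌋ = l`, an interval of length `|b|⁻¹`. -/
def cell (b : ℝ) (l : ℤ) : Set ℝ := {t | ⌊t * b⌋ = l}

theorem measurableSet_cell (b : ℝ) (l : ℤ) : MeasurableSet (cell b l) :=
  (Int.measurable_floor.comp (measurable_id.mul_const b)) (measurableSet_singleton l)

theorem exists_cell_ae_eq_Ioc {b : ℝ} (hb : b ≠ 0) (l : ℤ) :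
    ∃ s : ℝ, cell b l =ᵐ[volume] Set.Ioc s (s + |b|⁻¹) := by
  rcases hb.lt_or_gt with h | h
  · refine ⟨(l + 1) / b, ?_⟩
    have : cell b l = Set.Ioc ((l + 1) / b) ((l + 1) / b + |b|⁻¹) := by
      ext t
      rw [cell, Set.mem_ofPred_eq, Int.floor_eq_iff, Set.mem_Ioc, abs_of_neg h, div_lt_iff_of_neg h,
        show ((l : ℝ) + 1) / b + (-b)⁻¹ = l / b by field_simp; ring, le_div_iff_of_neg h]
      exact and_comm
    rw [this]
    exact Filter.EventuallyEq.rfl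
  · refine ⟨l / b, ?_⟩
    have : cell b l = Set.Ico (l / b : ℝ) (l / b + |b|⁻¹) := by
      ext t
      rw [cell, Set.mem_ofPred_eq, Int.floor_eq_iff, Set.mem_Ico, abs_of_pos h, div_le_iff₀ h,
        show (l : ℝ) / b + b⁻¹ = (l + 1) / b by field_simp, lt_div_iff₀ h]
    rw [this]
    exact Ico_ae_eq_Ioc

theorem add_mem_cell_iff {b : ℝ} (hb : b ≠ 0) (k l : ℤ) (t : ℝ) :
    t + k / b ∈ cell b (l + k) ↔ t ∈ cell b l := by
  rw [cell, cell, Set.mem_ofPred_eq, Set.mem_ofPred_eq, add_mul, div_mul_cancel₀ _ hb,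
    Int.floor_add_intCast, add_left_inj]

theorem char_add {b : ℝ} (hb : b ≠ 0) (m k : ℤ) (t : ℝ) :
    char b m (t + k / b) = char b m t := by
  have hb' : (b : ℂ) ≠ 0 := by exact_mod_cast hb
  rw [char, char, Complex.exp_eq_exp_iff_exists_int]
  refine ⟨m * k, ?_⟩
  push_cast
  field_simp

/-- Parseval's identity on a cell. -/
theorem hasSum_cell {b : ℝ} (hb : b ≠ 0) (l : ℤ) {F H : ℝ → ℂ}
    (hF : MemLp F 2 (volume : Measure ℝ)) (hH : MemLp H 2 (volume : Measure ℝ)) :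
    HasSum (fun m : ℤ => conj (∫ t in cell b l, conj (char b m t) * H t) *
        ∫ t in cell b l, conj (char b m t) * F t)
      ((|b|⁻¹ : ℝ) * ∫ t in cell b l, conj (H t) * F t) := by
  obtain ⟨s, hs⟩ := exists_cell_ae_eq_Ioc hb l
  have hT : s < s + |b|⁻¹ := by
    have := abs_pos.2 hb
    have : 0 < |b|⁻¹ := by positivity
    linarith
  simp only [setIntegral_congr_set hs]
  have hb' : ((|b| : ℝ) : ℂ) ≠ 0 := by exact_mod_cast (abs_pos.2 hb).ne'
  have key : HasSum (fun m : ℤ =>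
      conj (∫ t in Set.Ioc s (s + |b|⁻¹), conj (char |b| m t) * H t) *
        ∫ t in Set.Ioc s (s + |b|⁻¹), conj (char |b| m t) * F t)
      ((|b|⁻¹ : ℝ) * ∫ t in Set.Ioc s (s + |b|⁻¹), conj (H t) * F t) := by
    -- The square removes the factor `T⁻¹` carried by each Fourier coefficient, with `T = |b|⁻¹`.
    have h := (hasSum_conj_fourierCoeffOn_mul hT (hF.restrict _) (hH.restrict _)).mul_left
      (((|b|⁻¹ : ℝ) : ℂ) ^ 2)
    simp only [fourierCoeffOn_eq_setIntegral, inv_inv] at h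
    convert! h using 1
    · funext m
      generalize ∫ t in Set.Ioc s (s + |b|⁻¹), conj (char |b| m t) * H t = A
      generalize ∫ t in Set.Ioc s (s + |b|⁻¹), conj (char |b| m t) * F t = A'
      rw [map_mul, Complex.conj_ofReal]
      push_cast
      field_simp
    · generalize ∫ t in Set.Ioc s (s + |b|⁻¹), conj (H t) * F t = A
      push_cast
      field_simp
  rcases hb.lt_or_gt with h | h
  -- Replacing `b` by `|b| = -b` conjugates the characters, which amounts to reindexing by `m ↦ -m`.
  · rw [← (Equiv.neg ℤ).hasSum_iff]
    convert key using 2 with m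
    simp [char, abs_of_neg h]
  · simpa only [abs_of_pos h] using key

theorem inner_system (a b : ℝ) (g f : L2) (p : ℤ × ℤ) :
    inner ℂ (system a b g p) f =
      ∫ t, conj (char b p.1 t) * (conj (g (t - p.2 * a)) * f t) := by
  rw [L2.inner_def]
  apply integral_congr_ae
  filter_upwards [coeFn_system a b g p] with t ht
  rw [ht, RCLike.inner_apply', map_mul, mul_assoc]
  rfl

theorem aestronglyMeasurable_comp_sub (g : L2) (c : ℝ) :
    AEStronglyMeasurable (fun t => g (t - c)) volume :=
  ((Lp.stronglyMeasurable g).comp_measurable (measurable_sub_const c)).aestronglyMeasurable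

theorem memLp_comp_sub (g : L2) (c : ℝ) :
    MemLp (fun t => g (t - c)) 2 (volume : Measure ℝ) :=
  (Lp.memLp g).comp_measurePreserving (measurePreserving_sub_right volume c)

theorem ae_comp_sub {p : ℝ → Prop} (h : ∀ᵐ t, p t) (c : ℝ) : ∀ᵐ t, p (t - c) :=
  (measurePreserving_sub_right volume c).quasiMeasurePreserving.ae h

/-- Multiplication by a bounded function is a bounded operator on `L²(ℝ)`. -/
theorem exists_mul_clm {G : ℝ → ℂ} (hG : AEStronglyMeasurable G volume) {C : ℝ}
    (hC : ∀ᵐ t, ‖G t‖ ≤ C) :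
    ∃ T : L2 →L[ℂ] L2, ∀ f : L2, T f =ᵐ[volume] fun t => f t * G t := by
  have hm : ∀ f : L2, MemLp (fun t => f t * G t) 2 volume := fun f =>
    (Lp.memLp f).of_le_mul (c := C) ((Lp.aestronglyMeasurable f).mul hG) <| by
      filter_upwards [hC] with t ht
      rw [norm_mul, mul_comm]
      gcongr
  have hT : ∀ f, ((hm f).toLp : ℝ → ℂ) =ᵐ[volume] fun t => f t * G t := fun f =>
    (hm f).coeFn_toLp
  refine ⟨LinearMap.mkContinuous
    { toFun := fun f => (hm f).toLp
      map_add' := fun f h => ?_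
      map_smul' := fun c f => ?_ } C fun f => ?_, hT⟩
  · apply Lp.ext
    filter_upwards [hT (f + h), hT f, hT h, Lp.coeFn_add f h,
      Lp.coeFn_add (hm f).toLp (hm h).toLp] with t h1 h2 h3 h4 h5
    rw [h1, h5, Pi.add_apply, h2, h3, h4, Pi.add_apply, add_mul]
  · apply Lp.ext
    filter_upwards [hT (c • f), hT f, Lp.coeFn_smul c f, Lp.coeFn_smul c (hm f).toLp]
      with t h1 h2 h3 h4
    rw [h1, RingHom.id_apply, h4, Pi.smul_apply, h2, h3, Pi.smul_apply, smul_eq_mul, smul_eq_mul,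
      mul_assoc]
  · refine Lp.norm_le_mul_norm_of_ae_le_mul ?_
    filter_upwards [hT f, hC] with t h1 h2
    change ‖((hm f).toLp : ℝ → ℂ) t‖ ≤ _
    rw [h1, norm_mul, mul_comm]
    gcongr

/-! ### Restriction to cells -/

theorem exists_cellProj (b : ℝ) (l : ℤ) :
    ∃ T : L2 →L[ℂ] L2, ∀ f : L2, T f =ᵐ[volume] (cell b l).indicator f := by
  obtain ⟨T, hT⟩ := exists_mul_clm (G := (cell b l).indicator 1) (C := 1)
    ((measurable_one.indicator (measurableSet_cell b l)).aestronglyMeasurable)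
    (Filter.Eventually.of_forall fun t => (norm_indicator_le_norm_self _ _).trans (by simp))
  refine ⟨T, fun f => (hT f).trans (Filter.Eventually.of_forall fun t => ?_)⟩
  by_cases ht : t ∈ cell b l <;> simp [ht]

/-- The projection of `L²(ℝ)` that restricts a function to a cell. -/
def cellProj (b : ℝ) (l : ℤ) : L2 →L[ℂ] L2 := (exists_cellProj b l).choose

theorem coeFn_cellProj (b : ℝ) (l : ℤ) (f : L2) :
    cellProj b l f =ᵐ[volume] (cell b l).indicator f :=
  (exists_cellProj b l).choose_spec f

theorem inner_cellProj_cellProj (b : ℝ) {l m : ℤ} (h : l ≠ m) (f f' : L2) :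
    inner ℂ (cellProj b l f) (cellProj b m f') = 0 := by
  rw [L2.inner_def, ← integral_zero ℝ ℂ]
  apply integral_congr_ae
  filter_upwards [coeFn_cellProj b l f, coeFn_cellProj b m f'] with t h1 h2
  rw [h1, h2]
  by_cases h3 : t ∈ cell b l
  · have h4 : t ∉ cell b m := fun h4 => h (h3.symm.trans h4)
    simp [h4]
  · simp [h3]

/-- A closed subspace that contains all functions supported in a cell is everything. -/
theorem mem_of_forall_cellProj_mem (b : ℝ) (V : Submodule ℂ L2) (hV : IsClosed (V : Set L2))
    (h : ∀ l f, cellProj b l f ∈ V) (f : L2) : f ∈ V := by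
  have : CompleteSpace V := hV.completeSpace_coe
  have hV' : Vᗮ = ⊥ := by
    rw [Submodule.eq_bot_iff]
    intro u hu
    have h1 : ∀ l, cellProj b l u = 0 := by
      intro l
      rw [← inner_self_eq_zero (𝕜 := ℂ)]
      have h2 : inner ℂ (cellProj b l u) u = 0 := (Submodule.mem_orthogonal _ _).1 hu _ (h l u)
      rw [← h2, L2.inner_def, L2.inner_def]
      apply integral_congr_ae
      filter_upwards [coeFn_cellProj b l u] with t ht
      rw [ht]
      by_cases h3 : t ∈ cell b l <;> simp [h3]
    apply Lp.ext
    have h4 : ∀ᵐ t, ∀ l, (cell b l).indicator u t = 0 := by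
      rw [ae_all_iff]
      intro l
      filter_upwards [coeFn_cellProj b l u, Lp.coeFn_zero ℂ 2 (volume : Measure ℝ)] with t h5 h6
      rw [← h5, h1, h6, Pi.zero_apply]
    filter_upwards [h4, Lp.coeFn_zero ℂ 2 (volume : Measure ℝ)] with t h5 h6
    rw [h6, Pi.zero_apply, ← h5 ⌊t * b⌋]
    exact (Set.indicator_of_mem (show t ∈ cell b ⌊t * b⌋ from rfl) _).symm
  rw [Submodule.orthogonal_eq_bot_iff] at hV'
  rw [hV']
  trivial

/-! ### Pointwise bounds from the preframe condition -/

/-- Parseval on the cell applied to `conj (g (t - n a))` cut off to `E`. -/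
theorem hasSum_norm_inner_system_indicator {b : ℝ} (hb : b ≠ 0) (a : ℝ) (g : L2) {l : ℤ}
    {E : Set ℝ} (hE : MeasurableSet E) (hE' : volume E ≠ ⊤) (hEl : E ⊆ cell b l) (n : ℤ) :
    HasSum (fun m : ℤ => ‖inner ℂ (system a b g (m, n)) (indicatorConstLp 2 hE hE' (1 : ℂ))‖ ^ 2)
      (|b|⁻¹ * ∫ t in E, ‖g (t - n * a)‖ ^ 2) := by
  have hF : MemLp (E.indicator fun t => conj (g (t - n * a))) 2 volume :=
    (memLp_comp_sub g (n * a)).star.indicator hE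
  have h := hasSum_cell hb l hF hF
  have h1 : ∀ m : ℤ, inner ℂ (system a b g (m, n)) (indicatorConstLp 2 hE hE' (1 : ℂ)) =
      ∫ t in cell b l, conj (char b m t) * E.indicator (fun t => conj (g (t - n * a))) t := by
    intro m
    rw [inner_system, ← integral_indicator (measurableSet_cell b l)]
    apply integral_congr_ae
    filter_upwards [indicatorConstLp_coeFn (p := 2) (hs := hE) (hμs := hE') (c := (1 : ℂ))]
      with t ht
    rw [ht]
    by_cases h3 : t ∈ E
    · simp [h3, hEl h3]
    · simp [h3, Set.indicator]
  have h2 : ∫ t in cell b l, conj (E.indicator (fun t => conj (g (t - n * a))) t) *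
      E.indicator (fun t => conj (g (t - n * a))) t =
        ((∫ t in E, ‖g (t - n * a)‖ ^ 2 : ℝ) : ℂ) := by
    rw [← integral_complex_ofReal, ← integral_indicator (measurableSet_cell b l),
      ← integral_indicator hE]
    congr 1
    funext t
    by_cases h3 : t ∈ E
    · simp [h3, hEl h3, Complex.mul_conj']
    · simp [h3, Set.indicator]
  rw [h2] at h
  simp only [← h1, Complex.conj_mul'] at h
  exact_mod_cast h

/-- Summing the Parseval identity for the indicator of `E` over `n` bounds the integral of the
series over `E` by `|b| |B|` times the measure of `E`. As `E` is an arbitrary finite-measure part of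
a cell, the bound holds pointwise. -/
theorem exists_ae_tsum_sq_le {a b : ℝ} (hb : b ≠ 0) {g : L2} (hg : IsPreframe a b g) :
    ∃ C : ℝ, 0 ≤ C ∧ ∀ᵐ t : ℝ, Summable (fun n : ℤ => ‖g (t - n * a)‖ ^ 2) ∧
      ∑' n : ℤ, ‖g (t - n * a)‖ ^ 2 ≤ C := by
  obtain ⟨B, hB⟩ := hg
  refine ⟨|b| * |B|, by positivity, ?_⟩
  have hmeas : ∀ n : ℤ, Measurable fun t => ENNReal.ofReal (‖g (t - n * a)‖ ^ 2) := fun n =>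
    ((((Lp.stronglyMeasurable g).comp_measurable
      (measurable_sub_const (n * a : ℝ))).measurable.norm).pow_const 2).ennreal_ofReal
  have key : ∀ l : ℤ, ∀ᵐ t ∂volume.restrict (cell b l),
      ∑' n : ℤ, ENNReal.ofReal (‖g (t - n * a)‖ ^ 2) ≤ ENNReal.ofReal (|b| * |B|) := by
    intro l
    refine ae_le_of_forall_setLIntegral_le_of_sigmaFinite (Measurable.tsum hmeas) ?_
    intro s hs hs'
    rw [Measure.restrict_apply hs] at hs'
    rw [Measure.restrict_restrict hs, lintegral_tsum fun n => (hmeas n).aemeasurable,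
      setLIntegral_const]
    have hE := hs.inter (measurableSet_cell b l)
    set E := s ∩ cell b l
    set f := indicatorConstLp 2 hE hs'.ne (1 : ℂ)
    have h1 := fun n => hasSum_norm_inner_system_indicator hb a g hE hs'.ne
      Set.inter_subset_right n
    have h2 : ∀ n : ℤ, ∫⁻ t in E, ENNReal.ofReal (‖g (t - n * a)‖ ^ 2) =
        ENNReal.ofReal (|b| * ∑' m : ℤ, ‖inner ℂ (system a b g (m, n)) f‖ ^ 2) := by
      intro n
      rw [(h1 n).tsum_eq, mul_inv_cancel_left₀ (abs_pos.2 hb).ne',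
        ofReal_integral_eq_lintegral_ofReal]
      · exact (memLp_comp_sub g (n * a)).norm.integrable_sq.restrict
      · exact Filter.Eventually.of_forall fun t => by positivity
    have h3 := ((Equiv.prodComm ℤ ℤ).summable_iff.2 (hB f).1)
    have h4 : Summable fun n : ℤ => ∑' m : ℤ, ‖inner ℂ (system a b g (m, n)) f‖ ^ 2 := h3.prod
    rw [tsum_congr h2, ← ENNReal.ofReal_tsum_of_nonneg 
      (fun n => mul_nonneg (abs_nonneg b) (tsum_nonneg fun m => by positivity))
      (h4.mul_left |b|), tsum_mul_left]
    have h5 : ∑' n : ℤ, ∑' m : ℤ, ‖inner ℂ (system a b g (m, n)) f‖ ^ 2 ≤ |B| * ‖f‖ ^ 2 := by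
      have h6 := ((Equiv.prodComm ℤ ℤ).tsum_eq
        fun p => ‖inner ℂ (system a b g p) f‖ ^ 2).symm.trans h3.tsum_prod
      refine h6.symm.le.trans ((hB f).2.trans ?_)
      gcongr
      exact le_abs_self B
    have h7 : volume E = ENNReal.ofReal (‖f‖ ^ 2) := by
      rw [norm_indicatorConstLp two_ne_zero ENNReal.ofNat_ne_top, norm_one, one_mul,
        ENNReal.toReal_ofNat, ← Real.sqrt_eq_rpow, Real.sq_sqrt measureReal_nonneg,
        ofReal_measureReal hs'.ne]
    rw [h7, ← ENNReal.ofReal_mul (by positivity), mul_assoc]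
    gcongr
  have key' : ∀ᵐ t : ℝ, ∀ l : ℤ, t ∈ cell b l →
      ∑' n : ℤ, ENNReal.ofReal (‖g (t - n * a)‖ ^ 2) ≤ ENNReal.ofReal (|b| * |B|) :=
    ae_all_iff.2 fun l => (ae_restrict_iff' (measurableSet_cell b l)).1 (key l)
  filter_upwards [key'] with t ht
  have h := ht ⌊t * b⌋ rfl
  have hs : Summable fun n : ℤ => ‖g (t - n * a)‖ ^ 2 := by
    have h1 := ENNReal.summable_toReal (h.trans_lt ENNReal.ofReal_lt_top).ne
    refine h1.congr fun n => ?_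
    rw [ENNReal.toReal_ofReal (by positivity)]
  refine ⟨hs, ?_⟩
  rwa [← ENNReal.ofReal_tsum_of_nonneg (fun n => by positivity) hs,
    ENNReal.ofReal_le_ofReal_iff (by positivity)] at h

theorem summable_norm_mul_norm_and_tsum_le {u v : ℤ → ℂ} {C : ℝ}
    (hu : Summable fun n => ‖u n‖ ^ 2) (hu' : ∑' n, ‖u n‖ ^ 2 ≤ C)
    (hv : Summable fun n => ‖v n‖ ^ 2) (hv' : ∑' n, ‖v n‖ ^ 2 ≤ C) :
    Summable (fun n => ‖u n‖ * ‖v n‖) ∧ ∑' n, ‖u n‖ * ‖v n‖ ≤ C := by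
  have h : ∀ n, ‖u n‖ * ‖v n‖ ≤ (‖u n‖ ^ 2 + ‖v n‖ ^ 2) / 2 := fun n => by
    nlinarith [sq_nonneg (‖u n‖ - ‖v n‖)]
  have hs := (hu.add hv).div_const 2
  have hs' : Summable (fun n => ‖u n‖ * ‖v n‖) :=
    Summable.of_nonneg_of_le (fun n => by positivity) h hs
  refine ⟨hs', (hs'.tsum_le_tsum h hs).trans ?_⟩
  rw [tsum_div_const, hu.tsum_add hv]
  linarith

/-- The series that defines `G_k` converges absolutely almost everywhere and is bounded. -/
theorem exists_ae_corr_bound {a b : ℝ} (hb : b ≠ 0) {g : L2} (hg : IsPreframe a b g) :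
    ∃ C : ℝ, 0 ≤ C ∧ (∀ᵐ t, ‖g t‖ ≤ C) ∧ ∀ k : ℤ, ∀ᵐ t : ℝ,
      Summable (fun n : ℤ => ‖g (t - n * a)‖ * ‖g (t - n * a - k / b)‖) ∧
      ∑' n : ℤ, ‖g (t - n * a)‖ * ‖g (t - n * a - k / b)‖ ≤ C := by
  obtain ⟨C, hC0, hC⟩ := exists_ae_tsum_sq_le hb hg
  -- `C + 1` also bounds `‖g t‖`, because `2 ‖g t‖ ≤ ‖g t‖ ^ 2 + 1`.
  refine ⟨C + 1, by positivity, ?_, fun k => ?_⟩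
  · filter_upwards [hC] with t ht
    have h := (ht.1.le_tsum 0 fun n _ => by positivity).trans ht.2
    simp only [Int.cast_zero, zero_mul, sub_zero] at h
    nlinarith [sq_nonneg (‖g t‖ - 1), norm_nonneg (g t)]
  · filter_upwards [hC, ae_comp_sub hC (k / b)] with t h1 h2
    simp only [sub_right_comm t (k / b : ℝ)] at h2
    have h := summable_norm_mul_norm_and_tsum_le h1.1 h1.2 h2.1 h2.2
    exact ⟨h.1, h.2.trans (by linarith)⟩

theorem hasSum_corr {a b : ℝ} {g : L2} {k : ℤ} {t : ℝ}
    (h : Summable (fun n : ℤ => ‖g (t - n * a)‖ * ‖g (t - n * a - k / b)‖)) :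
    HasSum (fun n : ℤ => g (t - n * a) * conj (g (t - n * a - k / b))) (corr a b g k t) := by
  refine Summable.hasSum (Summable.of_norm ?_)
  simpa only [norm_mul, RCLike.norm_conj] using h

theorem aestronglyMeasurable_corr_term (a b : ℝ) (g : L2) (k n : ℤ) :
    AEStronglyMeasurable (fun t : ℝ => g (t - n * a) * conj (g (t - n * a - k / b))) volume := by
  simp only [sub_sub]
  exact (aestronglyMeasurable_comp_sub g _).mul
    (Complex.continuous_conj.comp_aestronglyMeasurable (aestronglyMeasurable_comp_sub g _))

/-! ### The Walnut operators and the frame operator on cells -/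

theorem exists_walnut_operator {a b : ℝ} (hb : b ≠ 0) {g : L2} (hg : IsPreframe a b g) (k : ℤ) :
    ∃ W : L2 →L[ℂ] L2, ∀ f : L2, (W f : ℝ → ℂ) =ᵐ[volume]
      fun t : ℝ => f (t - k / b) * corr a b g k t := by
  obtain ⟨C, -, -, hC⟩ := exists_ae_corr_bound hb hg
  have h1 : AEStronglyMeasurable (corr a b g k) volume := by
    refine aestronglyMeasurable_of_tendsto_ae (u := (Filter.atTop : Filter (Finset ℤ)))
      (f := fun s t => ∑ n ∈ s, g (t - n * a) * conj (g (t - n * a - k / b)))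
      (fun s => ?_) ?_
    · exact Finset.aestronglyMeasurable_fun_sum s fun n _ =>
        aestronglyMeasurable_corr_term a b g k n
    · filter_upwards [hC k] with t ht
      exact hasSum_corr ht.1
  obtain ⟨T, hT⟩ := exists_mul_clm h1 (C := C) <| by
    filter_upwards [hC k] with t ht
    refine ((norm_tsum_le_tsum_norm ?_).trans ?_).trans ht.2
    · simpa only [norm_mul, RCLike.norm_conj] using ht.1
    · simp only [norm_mul, RCLike.norm_conj, le_refl]
  refine ⟨T.comp (Lp.compMeasurePreservingₗᵢ ℂ (fun x : ℝ => x - k / b)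
    (measurePreserving_sub_right volume (k / b : ℝ))).toContinuousLinearMap, fun f => ?_⟩
  refine (hT _).trans ?_
  filter_upwards [Lp.coeFn_compMeasurePreserving f
    (measurePreserving_sub_right (volume : Measure ℝ) (k / b))] with t ht
  exact congrArg (· * _) ht

/-- Boundedness of `g` keeps these products in `L²`, as Parseval on a cell requires. -/
theorem memLp_conj_comp_sub_mul {g : L2} {C : ℝ} (hC : ∀ᵐ t, ‖g t‖ ≤ C) (c : ℝ) (f : L2) :
    MemLp (fun t => conj (g (t - c)) * f t) 2 volume := by
  refine (Lp.memLp f).of_le_mul (c := C) ((Complex.continuous_conj.comp_aestronglyMeasurable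
    (aestronglyMeasurable_comp_sub g c)).mul (Lp.aestronglyMeasurable f)) ?_
  filter_upwards [ae_comp_sub hC c] with t ht
  rw [norm_mul, RCLike.norm_conj]
  gcongr

theorem inner_walnut_eq_integral {a b : ℝ} {g : L2} {k : ℤ} {W : L2 →L[ℂ] L2}
    (hW : ∀ f : L2, (W f : ℝ → ℂ) =ᵐ[volume] fun t : ℝ => f (t - k / b) * corr a b g k t)
    (φ f : L2) :
    inner ℂ φ (W f) = ∫ t, conj (φ t) * (f (t - k / b) * corr a b g k t) := by
  rw [L2.inner_def]
  apply integral_congr_ae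
  filter_upwards [hW f] with t ht
  rw [ht, RCLike.inner_apply']

theorem integrable_walnut {a b : ℝ} {g : L2} {k : ℤ} {W : L2 →L[ℂ] L2}
    (hW : ∀ f : L2, (W f : ℝ → ℂ) =ᵐ[volume] fun t : ℝ => f (t - k / b) * corr a b g k t)
    (φ f : L2) :
    Integrable fun t => conj (φ t) * (f (t - k / b) * corr a b g k t) := by
  refine (L2.integrable_inner (𝕜 := ℂ) φ (W f)).congr ?_
  filter_upwards [hW f] with t ht
  rw [ht, RCLike.inner_apply']

theorem hasSum_inner_mul_inner_system {a b : ℝ} {g : L2} (hg : IsPreframe a b g) (φ f : L2) :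
    HasSum (fun p => inner ℂ (system a b g p) f * inner ℂ φ (system a b g p))
      (inner ℂ φ (frameOperator a b g f)) := by
  have h := ((innerSL ℂ φ).hasSum (summable_frameOperator a b g hg f).hasSum)
  simpa [inner_smul_right, frameOperator] using h

/-- The sum over the modulations, for functions supported in two cells. -/
theorem hasSum_modulations {a b : ℝ} (hb : b ≠ 0) {g : L2} (hg : IsPreframe a b g) {k l : ℤ}
    {φ f : L2} (hf : ∀ᵐ t, t ∉ cell b l → f t = 0) (hφ : ∀ᵐ t, t ∉ cell b (l + k) → φ t = 0)
    (n : ℤ) :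
    HasSum (fun m : ℤ => inner ℂ (system a b g (m, n)) f * inner ℂ φ (system a b g (m, n)))
      ((|b|⁻¹ : ℝ) * ∫ t, conj (φ t) *
        (f (t - k / b) * (g (t - n * a) * conj (g (t - n * a - k / b))))) := by
  obtain ⟨C, -, hC, -⟩ := exists_ae_corr_bound hb hg
  -- The factor with `φ` is shifted by `k / b` so that both lie in cell `l`; the characters are
  -- unchanged by this shift.
  have hF := memLp_conj_comp_sub_mul hC (n * a) f
  have hH := (memLp_conj_comp_sub_mul hC (n * a) φ).comp_measurePreserving
    (measurePreserving_add_right volume (k / b : ℝ))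
  have hφ' : ∀ᵐ t : ℝ, t ∉ cell b l → φ (t + k / b) = 0 := by
    filter_upwards [(measurePreserving_add_right volume (k / b : ℝ)).quasiMeasurePreserving.ae hφ]
      with t ht h
    exact ht (mt (add_mem_cell_iff hb k l t).1 h)
  convert! hasSum_cell hb l hF hH using 1
  · funext m
    rw [mul_comm, ← inner_conj_symm, inner_system, inner_system]
    congr 1
    · rw [← integral_add_right_eq_self _ (k / b : ℝ)]
      simp only [char_add hb, Function.comp_def]
      rw [setIntegral_eq_integral_of_ae_compl_eq_zero]
      filter_upwards [hφ'] with t ht h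
      simp [ht h]
    · rw [setIntegral_eq_integral_of_ae_compl_eq_zero]
      filter_upwards [hf] with t ht h
      simp [ht h]
  · rw [setIntegral_eq_integral_of_ae_compl_eq_zero,
      ← integral_add_right_eq_self _ (k / b : ℝ)]
    · congr! 3 with t
      rw [sub_right_comm _ (n * a : ℝ), add_sub_cancel_right, Function.comp_apply, map_mul,
        Complex.conj_conj]
      ring
    · filter_upwards [hf] with t ht h
      simp [ht h]

/-- The sum over the translations. -/
theorem hasSum_translations {a b : ℝ} (hb : b ≠ 0) {g : L2} (hg : IsPreframe a b g) (k : ℤ)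
    (φ f : L2) :
    HasSum (fun n : ℤ => ∫ t, conj (φ t) *
        (f (t - k / b) * (g (t - n * a) * conj (g (t - n * a - k / b)))))
      (∫ t, conj (φ t) * (f (t - k / b) * corr a b g k t)) := by
  obtain ⟨C, -, -, hC⟩ := exists_ae_corr_bound hb hg
  have hmeas : ∀ c : ℝ, Measurable fun t => ‖g (t - c)‖ := fun c =>
    ((Lp.stronglyMeasurable g).comp_measurable (measurable_sub_const c)).measurable.norm
  refine hasSum_integral_of_dominated_convergence
    (fun n t => ‖φ t‖ * ‖f (t - k / b)‖ * (‖g (t - n * a)‖ * ‖g (t - n * a - k / b)‖))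
    (fun n => ?_) (fun n => Filter.Eventually.of_forall fun t => ?_) ?_ ?_ ?_
  · exact (Complex.continuous_conj.comp_aestronglyMeasurable (Lp.aestronglyMeasurable φ)).mul
      ((aestronglyMeasurable_comp_sub f _).mul (aestronglyMeasurable_corr_term a b g k n))
  · simp only [norm_mul, RCLike.norm_conj, mul_assoc, le_refl]
  · filter_upwards [hC k] with t ht
    exact ht.1.mul_left _
  · simp only [tsum_mul_left]
    have h1 := (Lp.memLp φ).norm.integrable_mul (memLp_comp_sub f (k / b)).norm
    refine (h1.mul_const C).mono' (h1.aestronglyMeasurable.mul ?_) ?_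
    · refine (Measurable.tsum fun n => ?_).aestronglyMeasurable
      simp only [sub_sub]
      exact (hmeas _).mul (hmeas _)
    · filter_upwards [hC k] with t ht
      rw [Real.norm_of_nonneg (mul_nonneg (by positivity) (tsum_nonneg fun n => by positivity))]
      exact mul_le_mul_of_nonneg_left ht.2 (by positivity)
  · filter_upwards [hC k] with t ht
    exact ((hasSum_corr ht.1).mul_left _).mul_left _

/-- The double series converges unconditionally, so it may be summed over modulations first and over
translations afterwards. -/
theorem inner_frameOperator_of_cells {a b : ℝ} (hb : b ≠ 0) {g : L2} (hg : IsPreframe a b g)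
    {k l : ℤ} {φ f : L2} (hf : ∀ᵐ t, t ∉ cell b l → f t = 0)
    (hφ : ∀ᵐ t, t ∉ cell b (l + k) → φ t = 0) :
    inner ℂ φ (frameOperator a b g f) =
      (|b|⁻¹ : ℝ) * ∫ t, conj (φ t) * (f (t - k / b) * corr a b g k t) := by
  have h := (Equiv.prodComm ℤ ℤ).hasSum_iff.2 (hasSum_inner_mul_inner_system hg φ f)
  exact (h.prod_fiberwise fun n => hasSum_modulations hb hg hf hφ n).unique
    ((hasSum_translations hb hg k φ f).mul_left _)

theorem cellProj_apply_eq_zero (b : ℝ) (l : ℤ) (f : L2) :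
    ∀ᵐ t, t ∉ cell b l → cellProj b l f t = 0 := by
  filter_upwards [coeFn_cellProj b l f] with t ht h
  rw [ht, Set.indicator_of_notMem h]

theorem walnut_cellProj {a b : ℝ} (hb : b ≠ 0) {g : L2} {k : ℤ} {W : L2 →L[ℂ] L2}
    (hW : ∀ f : L2, (W f : ℝ → ℂ) =ᵐ[volume] fun t : ℝ => f (t - k / b) * corr a b g k t)
    (l : ℤ) (f : L2) : W (cellProj b l f) = cellProj b (l + k) (W f) := by
  apply Lp.ext
  filter_upwards [hW f, hW (cellProj b l f), coeFn_cellProj b (l + k) (W f),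
    ae_comp_sub (coeFn_cellProj b l f) (k / b)] with t h1 h2 h3 h4
  have h5 := add_mem_cell_iff hb k l (t - k / b)
  rw [sub_add_cancel] at h5
  rw [h2, h3, h4]
  by_cases h : t ∈ cell b (l + k)
  · simp [h, h5.1 h, h1]
  · simp [h, mt h5.2 h]

/-! ### Hilbert space arguments -/

section Hilbert

variable {E : Type*} [NormedAddCommGroup E] [InnerProductSpace ℂ E]

/-- By Pythagoras, the bound on partial sums bounds the sums of `‖v k‖ ^ 2`. -/
theorem summable_of_pairwise_orthogonal [CompleteSpace E] {v : ℤ → E}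
    (hv : ∀ i j, i ≠ j → inner ℂ (v i) (v j) = 0) {C : ℝ}
    (hC : ∀ M : Finset ℤ, ‖∑ k ∈ M, v k‖ ≤ C) : Summable v := by
  have hO : OrthogonalFamily ℂ (fun k => (ℂ ∙ v k)) fun k => (ℂ ∙ v k).subtypeₗᵢ :=
    OrthogonalFamily.of_pairwise fun i j hij =>
      Submodule.isOrtho_span.2 fun x hx y hy => by
        rw [Set.mem_singleton_iff.1 hx, Set.mem_singleton_iff.1 hy, hv i j hij]
  let w : ∀ k, (ℂ ∙ v k) := fun k => ⟨v k, Submodule.mem_span_singleton_self (v k)⟩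
  refine (hO.summable_iff_norm_sq_summable w).2
    (summable_of_sum_le (c := C ^ 2) (fun k => by positivity) fun M => ?_)
  rw [← hO.norm_sum w M]
  exact pow_le_pow_left₀ (norm_nonneg _) (hC M) 2

/-- The subspace of the vectors on which a series of operators converges unconditionally. -/
def summableSubmodule (W : ℤ → E →L[ℂ] E) : Submodule ℂ E where
  carrier := {f | Summable fun k => W k f}
  add_mem' {f h} hf hh := by
    change Summable _
    simp only [map_add]
    exact Summable.add hf hh
  zero_mem' := by
    change Summable _
    simp only [map_zero]
    exact summable_zero
  smul_mem' c f hf := by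
    change Summable _
    simp only [map_smul]
    exact Summable.const_smul c hf

/-- The uniform bound makes the Cauchy condition pass from a nearby vector to a limit. -/
theorem isClosed_summableSubmodule [CompleteSpace E] {W : ℤ → E →L[ℂ] E} {C : ℝ}
    (hC : ∀ M : Finset ℤ, ‖∑ k ∈ M, W k‖ ≤ C) : IsClosed (summableSubmodule W : Set E) := by
  refine isClosed_of_closure_subset fun f hf => ?_
  change Summable fun k => W k f
  have hC0 : 0 ≤ C := (norm_nonneg _).trans (hC ∅)
  rw [summable_iff_vanishing_norm]
  intro ε hε
  obtain ⟨h, hh, hfh⟩ := Metric.mem_closure_iff.1 hf (ε / (2 * (C + 1))) (by positivity)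
  obtain ⟨s, hs⟩ := summable_iff_vanishing_norm.1 (show Summable fun k => W k h from hh) (ε / 2)
    (by positivity)
  refine ⟨s, fun t ht => ?_⟩
  have h1 : ∑ k ∈ t, W k f = (∑ k ∈ t, W k) (f - h) + ∑ k ∈ t, W k h := by
    simp
  have h2 : ‖(∑ k ∈ t, W k) (f - h)‖ ≤ (C + 1) * ‖f - h‖ :=
    ((∑ k ∈ t, W k).le_opNorm _).trans (by gcongr; linarith [hC t])
  rw [dist_eq_norm, lt_div_iff₀ (by positivity)] at hfh
  rw [h1]
  refine (norm_add_le _ _).trans_lt ?_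
  linarith [hs t ht]

theorem bddAbove_norm_sum_of_weak [CompleteSpace E] {W : ℤ → E →L[ℂ] E}
    (h : ∀ f φ : E, Summable fun k => (inner ℂ φ (W k f) : ℂ)) :
    BddAbove (Set.range fun M : Finset ℤ => ‖∑ k ∈ M, W k‖) := by
  have h1 : ∀ f : E, ∃ C, ∀ M : Finset ℤ, ‖(∑ k ∈ M, W k) f‖ ≤ C := by
    intro f
    -- Uniform boundedness is used first for the functionals given by the partial sums at a fixed
    -- `f`, then for the partial sums as operators. Scalar summability is absolute, which bounds all
    -- finite sums at once.
    obtain ⟨C, hC⟩ := banach_steinhaus (g := fun M : Finset ℤ => innerSL ℂ ((∑ k ∈ M, W k) f)) <| by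
      intro φ
      refine ⟨∑' k, ‖(inner ℂ φ (W k f) : ℂ)‖, fun M => ?_⟩
      rw [innerSL_apply_apply, norm_inner_symm, sum_apply, inner_sum]
      exact (norm_sum_le _ _).trans ((h f φ).norm.sum_le_tsum M fun k _ => norm_nonneg _)
    exact ⟨C, fun M => (innerSL_apply_norm ℂ _).symm.le.trans (hC M)⟩
  obtain ⟨C, hC⟩ := banach_steinhaus h1
  exact ⟨C, Set.forall_mem_range.2 hC⟩

/-- Complex polarization writes each sesquilinear form as a combination of four quadratic ones. -/
theorem hasSum_inner_of_hasSum_inner_self {W : ℤ → E →ₗ[ℂ] E} {S : E →ₗ[ℂ] E}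
    (h : ∀ f, HasSum (fun k => (inner ℂ f (W k f) : ℂ)) (inner ℂ f (S f))) (φ f : E) :
    HasSum (fun k => (inner ℂ φ (W k f) : ℂ)) (inner ℂ φ (S f)) := by
  have h1 : ∀ f, HasSum (fun k => (inner ℂ (W k f) f : ℂ)) (inner ℂ (S f) f) := fun f => by
    simpa only [inner_conj_symm] using Complex.hasSum_conj'.2 (h f)
  have h2 : HasSum (fun k => (inner ℂ (W k f) φ : ℂ)) (inner ℂ (S f) φ) := by
    simp only [inner_map_polarization' _ f φ]
    exact ((((h1 _).sub (h1 _)).sub ((h1 _).mul_left _)).add ((h1 _).mul_left _)).div_const 4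
  simpa only [inner_conj_symm] using Complex.hasSum_conj'.2 h2

end Hilbert

/-! ### The frame operator as a bounded operator -/

/-- The frame operator as a linear map. -/
def frameLinearMap {a b : ℝ} {g : L2} (hg : IsPreframe a b g) : L2 →ₗ[ℂ] L2 where
  toFun := frameOperator a b g
  map_add' f h := by
    simp only [frameOperator, inner_add_right, add_smul]
    exact (summable_frameOperator a b g hg f).tsum_add (summable_frameOperator a b g hg h)
  map_smul' c f := by
    simp only [frameOperator, inner_smul_right, mul_smul, RingHom.id_apply]
    exact (summable_frameOperator a b g hg f).tsum_const_smul c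

theorem isSymmetric_frameLinearMap {a b : ℝ} {g : L2} (hg : IsPreframe a b g) :
    (frameLinearMap hg).IsSymmetric := by
  intro f φ
  change inner ℂ (frameOperator a b g f) φ = inner ℂ f (frameOperator a b g φ)
  have h := Complex.hasSum_conj'.2 (hasSum_inner_mul_inner_system hg φ f)
  simp only [map_mul, inner_conj_symm] at h
  refine h.unique ?_
  simpa only [mul_comm] using hasSum_inner_mul_inner_system hg f φ

/-- The frame operator as a bounded operator. -/
def frameCLM {a b : ℝ} {g : L2} (hg : IsPreframe a b g) : L2 →L[ℂ] L2 :=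
  -- Hellinger–Toeplitz: an everywhere defined symmetric operator is bounded.
  ⟨frameLinearMap hg, (isSymmetric_frameLinearMap hg).continuous⟩

theorem inner_frameOperator_self {a b : ℝ} {g : L2} (hg : IsPreframe a b g) (f : L2) :
    inner ℂ f (frameOperator a b g f) =
      ((∑' p : ℤ × ℤ, ‖inner ℂ (system a b g p) f‖ ^ 2 : ℝ) : ℂ) := by
  rw [← (hasSum_inner_mul_inner_system hg f f).tsum_eq, Complex.ofReal_tsum]
  refine tsum_congr fun p => ?_
  rw [← inner_conj_symm f, Complex.mul_conj', Complex.ofReal_pow]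

/-! ### From cells to all of `L²` -/

variable {a b : ℝ} {g : L2} {W : ℤ → L2 →L[ℂ] L2}

theorem inner_cellProj_walnut_cellProj (hb : b ≠ 0)
    (hW : ∀ (k : ℤ) (f : L2), (W k f : ℝ → ℂ) =ᵐ[volume]
      fun t : ℝ => f (t - k / b) * corr a b g k t) {k l m : ℤ} (h : m ≠ l + k) (φ f : L2) :
    inner ℂ (cellProj b m φ) (W k (cellProj b l f)) = 0 := by
  rw [walnut_cellProj hb (hW k), inner_cellProj_cellProj b h]

theorem summable_walnut (hb : b ≠ 0)
    (hW : ∀ (k : ℤ) (f : L2), (W k f : ℝ → ℂ) =ᵐ[volume]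
      fun t : ℝ => f (t - k / b) * corr a b g k t)
    {C : ℝ} (hC : ∀ M : Finset ℤ, ‖∑ k ∈ M, W k‖ ≤ C) (f : L2) : Summable fun k => W k f := by
  refine mem_of_forall_cellProj_mem b (summableSubmodule W) (isClosed_summableSubmodule hC)
    (fun l f => ?_) f
  refine summable_of_pairwise_orthogonal (v := fun k => W k (cellProj b l f))
    (C := C * ‖cellProj b l f‖) (fun i j hij => ?_) fun M => ?_
  · simp only [walnut_cellProj hb (hW _)]
    exact inner_cellProj_cellProj b (by simpa using hij) _ _
  · rw [← sum_apply]
    exact (∑ k ∈ M, W k).le_of_opNorm_le (hC M) _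

theorem inner_cellProj_frameOperator (hb : b ≠ 0) (hg : IsPreframe a b g)
    (hW : ∀ (k : ℤ) (f : L2), (W k f : ℝ → ℂ) =ᵐ[volume]
      fun t : ℝ => f (t - k / b) * corr a b g k t) {l : ℤ} {f s : L2}
    (hs : HasSum (fun k => W k (cellProj b l f)) s) (m : ℤ) (φ : L2) :
    inner ℂ (cellProj b m φ) (frameOperator a b g (cellProj b l f)) =
      ((|b|⁻¹ : ℝ) : ℂ) * inner ℂ (cellProj b m φ) s := by
  have h1 : HasSum (fun k => inner ℂ (cellProj b m φ) (W k (cellProj b l f)))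
      (inner ℂ (cellProj b m φ) s) := (innerSL ℂ (cellProj b m φ)).hasSum hs
  -- Only `k = m - l` moves cell `l` onto cell `m`.
  have h2 := hasSum_single (f := fun k => inner ℂ (cellProj b m φ) (W k (cellProj b l f))) (m - l)
    fun k hk => inner_cellProj_walnut_cellProj hb hW (by omega) φ f
  rw [h1.unique h2, inner_walnut_eq_integral (hW (m - l))]
  refine inner_frameOperator_of_cells hb hg (cellProj_apply_eq_zero b l f) ?_
  rw [add_sub_cancel]
  exact cellProj_apply_eq_zero b m φ

theorem frameOperator_eq_walnut_sum (hb : b ≠ 0) (hg : IsPreframe a b g)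
    (hW : ∀ (k : ℤ) (f : L2), (W k f : ℝ → ℂ) =ᵐ[volume]
      fun t : ℝ => f (t - k / b) * corr a b g k t)
    {C : ℝ} (hC : ∀ M : Finset ℤ, ‖∑ k ∈ M, W k‖ ≤ C) (f : L2) :
    frameOperator a b g f = ((|b|⁻¹ : ℝ) : ℂ) • ∑' k, W k f := by
  have hs := summable_walnut hb hW hC
  let T : L2 →L[ℂ] L2 := LinearMap.mkContinuous
    { toFun := fun f => ∑' k, W k f
      map_add' := fun f h => by
        simp only [map_add]
        exact (hs f).tsum_add (hs h)
      map_smul' := fun c f => by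
        simp only [map_smul]
        exact (hs f).tsum_const_smul c } C fun f => by
    refine le_of_tendsto (hs f).hasSum.norm (Filter.Eventually.of_forall fun M => ?_)
    rw [← sum_apply]
    exact (∑ k ∈ M, W k).le_of_opNorm_le (hC M) _
  have key : f ∈ (frameCLM hg - ((|b|⁻¹ : ℝ) : ℂ) • T).ker := by
    refine mem_of_forall_cellProj_mem b _ (ContinuousLinearMap.isClosed_ker _) (fun l f => ?_) f
    rw [LinearMap.mem_ker]
    set x := (frameCLM hg - ((|b|⁻¹ : ℝ) : ℂ) • T) (cellProj b l f) with hx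
    -- If every function on a cell is orthogonal to `x`, so is `x` itself, whence `x = 0`.
    have h1 := mem_of_forall_cellProj_mem b (ℂ ∙ x)ᗮ (Submodule.isClosed_orthogonal _)
      (fun m φ => ?_) x
    · exact inner_self_eq_zero.1 (Submodule.mem_orthogonal_singleton_iff_inner_right.1 h1)
    · rw [Submodule.mem_orthogonal_singleton_iff_inner_left, hx, sub_apply,
        smul_apply, inner_sub_right, inner_smul_right, sub_eq_zero]
      exact inner_cellProj_frameOperator hb hg hW (hs _).hasSum m φ
  exact sub_eq_zero.1 (LinearMap.mem_ker.1 key)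

theorem frameIdentityHolds_iff (hg : IsPreframe a b g)
    (hW : ∀ (k : ℤ) (f : L2), (W k f : ℝ → ℂ) =ᵐ[volume]
      fun t : ℝ => f (t - k / b) * corr a b g k t) (f : L2) :
    FrameIdentityHolds a b g f ↔
      HasSum (fun k : ℤ => ((|b|⁻¹ : ℝ) : ℂ) * inner ℂ f (W k f))
        (inner ℂ f (frameOperator a b g f)) := by
  have h1 : Summable fun p : ℤ × ℤ => ‖inner ℂ (system a b g p) f‖ ^ 2 := by
    obtain ⟨B, hB⟩ := hg
    exact (hB f).1
  have h2 := fun k => integrable_walnut (hW k) f f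
  simp only [FrameIdentityHolds, inner_frameOperator_self hg, inner_walnut_eq_integral (hW _),
    mul_assoc, h1, h2, implies_true, true_and]

end WH

end

theorem mainTheorem3 (a b : ℝ) (hb : b ≠ 0) (g : WH.L2) (hg : WH.IsPreframe a b g) :
    -- `W k` is the operator `f ↦ (T_{k/b} f) G_k`, which is well defined and bounded
    ∃ W : ℤ → (WH.L2 →L[ℂ] WH.L2),
      (∀ (k : ℤ) (f : WH.L2), (W k f : ℝ → ℂ) =ᵐ[volume]
        fun t : ℝ => f (t - k / b) * WH.corr a b g k t) ∧
      List.TFAE [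
        ∀ f : WH.L2, WH.WeaklySummable (fun k => W k f),
        ∀ f : WH.L2, Summable (fun k => W k f),
        BddAbove (Set.range fun M : Finset ℤ => ‖∑ k ∈ M, W k‖),
        ∀ f : WH.L2, HasSum (fun k : ℤ => ((|b|⁻¹ : ℝ) : ℂ) * inner ℂ f (W k f))
          (inner ℂ f (WH.frameOperator a b g f)),
        ∀ f : WH.L2, WH.FrameIdentityHolds a b g f] := by
  choose W hW using WH.exists_walnut_operator hb hg
  have hb' : ((|b| : ℝ) : ℂ) ≠ 0 := by exact_mod_cast (abs_pos.2 hb).ne'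
  refine ⟨W, hW, ?_⟩
  tfae_have 2 → 1 := fun h f => ⟨∑' k, W k f, fun φ => (innerSL ℂ φ).hasSum (h f).hasSum⟩
  tfae_have 1 → 3 := fun h => WH.bddAbove_norm_sum_of_weak fun f φ =>
    ((h f).choose_spec φ).summable
  tfae_have 3 → 2 := fun ⟨C, hC⟩ => WH.summable_walnut hb hW (Set.forall_mem_range.1 hC)
  tfae_have 3 → 4 := by
    rintro ⟨C, hC⟩ f
    have hC' := Set.forall_mem_range.1 hC
    rw [WH.frameOperator_eq_walnut_sum hb hg hW hC', inner_smul_right]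
    exact ((innerSL ℂ f).hasSum (WH.summable_walnut hb hW hC' f).hasSum).mul_left _
  tfae_have 4 → 1 := by
    intro h f
    -- The weak limit must be `|b| S f`, since (4) carries the factor `|b|⁻¹`.
    refine ⟨((|b| : ℝ) : ℂ) • WH.frameOperator a b g f, fun φ => ?_⟩
    refine WH.hasSum_inner_of_hasSum_inner_self (W := fun k => (W k : WH.L2 →ₗ[ℂ] WH.L2))
      (S := ((|b| : ℝ) : ℂ) • WH.frameLinearMap hg) (fun f => ?_) φ f
    have h1 := (h f).mul_left ((|b| : ℝ) : ℂ)
    simp only [Complex.ofReal_inv, mul_inv_cancel_left₀ hb'] at h1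
    rw [LinearMap.smul_apply, inner_smul_right]
    exact h1
  tfae_have 4 ↔ 5 := forall_congr' fun f => (WH.frameIdentityHolds_iff hg hW f).symm
  tfae_finish
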